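/- Let $\Omega\subset\mathbb{R}^d$ be closed and convex, let $1<p<\infty$, and let $W_p(\Omega)$ be the set of probability measures on $\Omega$ with finite $p$-th moment, endowed with the Wasserstein distance of order $p$. A velocity field of a Lipschitz curve $\mu:[0,1]\to W_p(\Omega)$ is a vector field $v:[0,1]\times\Omega\to\mathbb{R}^d$ such that $v_t=v(t,\cdot)\in L^p(\mu_t;\mathbb{R}^d)$ for a.e. $t\in[0,1]$ and such that, for every $\phi\in C^1_c(\Omega)$ (the restrictions to $\Omega$ of functions in $C^1_c(\mathbb{R}^d)$), the function $s\mapsto\int_\Omega\nabla\phi\cdot v_s\,d\mu_s$ is integrable on $[0,1]$ and $$\int_\Omega\phi\,d\mu_{t_2}-\int_\Omega\phi\,d\mu_{t_1}=\int_{t_1}^{t_2}\int_\Omega\nabla\phi\cdot v_s\,d\mu_s\,ds\qquad\text{for all } t_1<t_2 \text{ in } [0,1].$$ **Theorem.** Let $\mu:[0,1]\to W_p(\Omega)$ be a Lipschitz curve with velocity field $v$. Let $T:[0,1]\times\Omega\to\Omega$ be smooth (that is, the restriction of a $C^\infty$ map defined on an open neighbourhood of $[0,1]\times\Omega$; derivatives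 are those of this map), and suppose that for every $t\in[0,1]$ the map $T_t=T(t,\cdot)$ is a diffeomorphism of $\Omega$ onto itself. Suppose also that there is a constant $C$ with $$\|\nabla T_t(x)\|\le C,\qquad \left|\frac{\partial T}{\partial t}(t,x)\right|\le C(1+|x|)\qquad\text{for all } t\in[0,1],\ x\in\Omega$$ (which is automatic if $\Omega$ is bounded). Put $\mu'_t=(T_t)_\sharp\mu_t$. Then $t\mapsto\mu'_t$ is a Lipschitz curve in $W_p(\Omega)$; there is a vector field $v'$ such that, for a.e. $t\in[0,1]$, $v'_t$ is $\mu'_t$-integrable and $$v'_t\cdot\mu'_t=(T_t)_\sharp\left[\left(\nabla T_t\cdot v_t+\frac{\partial T}{\partial t}\right)\mu_t\right]$$ as vector measures; and every such $v'$ is a velocity field for $\mu'$. -/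

import Mathlib

/-!
A test function `φ` is pulled back along `T` to the function `φ ∘ T` on space-time. Its support is
compact in `[0, 1] × Ω`: each preimage `{x ∈ Ω : |T_t x| ≤ r}` is the image of a connected compact
set under the inverse of `T_t`, so for `t` near `t₀` it stays inside a sphere that encloses
`{x ∈ Ω : |T_{t₀} x| ≤ r}`; hence `T` is proper on `[0, 1] × Ω`, with no bound on the inverses.

The continuity equation extends to test functions `Ψ` on space-time in the form
`d/dt ∫ Ψ(t, ·) dμ_t = ∫ (∂_t Ψ + ∇Ψ · v_t) dμ_t` for a.e. `t`, and the left-hand side integrates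
because `t ↦ ∫ Ψ(t, ·) dμ_t` is Lipschitz. For `Ψ = φ ∘ T` the chain rule gives
`∂_t Ψ + ∇Ψ · v_t = (∇φ ∘ T_t) · (∇T_t · v_t + ∂_t T)`. As `T_t` is injective, the vector measure
`v'_t · μ'_t` is the given push-forward exactly when `v'_t ∘ T_t = ∇T_t · v_t + ∂_t T` holds
`μ_t`-a.e., so this is the velocity field equation of `v'` tested against `φ`.
-/

open MeasureTheory Set
open scoped ENNReal NNReal ContDiff

/-- A coupling (transport plan) of `μ` and `ν`: a measure on the product with marginals
`μ` and `ν`. -/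
def IsCoupling {E : Type*} [MeasurableSpace E] (π : Measure (E × E)) (μ ν : Measure E) : Prop :=
  π.map Prod.fst = μ ∧ π.map Prod.snd = ν

/-- The Wasserstein distance of order `p`:
`W_p(μ, ν) = (inf over couplings π of ∫ |x - y| ^ p dπ) ^ (1 / p)`. -/
noncomputable def wassersteinDist {E : Type*} [MeasurableSpace E] [PseudoEMetricSpace E]
    (p : ℝ) (μ ν : Measure E) : ℝ≥0∞ :=
  (⨅ (π : Measure (E × E)) (_ : IsCoupling π μ ν), ∫⁻ z, edist z.1 z.2 ^ p ∂π) ^ (1 / p)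

/-- The set `W_p(Ω)` of probability measures on `Ω` with finite `p`-th moment. A measure on `Ω` is
represented by the measure on the ambient space that gives no mass to the complement of `Ω`. -/
def wassersteinSpace {E : Type*} [MeasurableSpace E] [NormedAddCommGroup E]
    (p : ℝ) (Ω : Set E) : Set (Measure E) :=
  {μ | IsProbabilityMeasure μ ∧ μ Ωᶜ = 0 ∧ ∫⁻ x, ‖x‖ₑ ^ p ∂μ < ⊤}

/-- `t ↦ μ t`, `t ∈ [0, 1]`, is a Lipschitz curve in `W_p(Ω)`.
Values of `μ` at times outside `[0, 1]` are irrelevant. -/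
def IsLipschitzCurve {E : Type*} [MeasurableSpace E] [NormedAddCommGroup E]
    (p : ℝ) (Ω : Set E) (μ : ℝ → Measure E) : Prop :=
  (∀ t ∈ Icc (0 : ℝ) 1, μ t ∈ wassersteinSpace p Ω) ∧
    ∃ L : ℝ≥0, ∀ s ∈ Icc (0 : ℝ) 1, ∀ t ∈ Icc (0 : ℝ) 1,
      wassersteinDist p (μ s) (μ t) ≤ L * edist s t

/-- `v` is a velocity field of the curve `μ` (for the exponent `p`): for a.e. `t` the field `v t`
belongs to `L^p(μ t)`, and the continuity equation holds in the integrated weak form.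
The test functions in `C¹_c(Ω)`, for closed `Ω`, are the restrictions to `Ω` of the functions in
`C¹_c(ℝ^d)`; as the measures `μ t` live on `Ω`, only these restrictions (and their gradients at
points of `Ω`) enter. `fderiv ℝ φ x (v s x)` is the scalar product of `∇φ(x)` and `v_s(x)`.
That the outer integrand is integrable in time is part of the definition. -/
def IsVelocityField {E : Type*} [MeasurableSpace E] [NormedAddCommGroup E] [NormedSpace ℝ E]
    (p : ℝ) (μ : ℝ → Measure E) (v : ℝ → E → E) : Prop :=
  (∀ᵐ t ∂(volume.restrict (Icc (0 : ℝ) 1)), MemLp (v t) (ENNReal.ofReal p) (μ t)) ∧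
    ∀ φ : E → ℝ, ContDiff ℝ 1 φ → HasCompactSupport φ →
      IntegrableOn (fun s => ∫ x, fderiv ℝ φ x (v s x) ∂(μ s)) (Icc (0 : ℝ) 1) volume ∧
        ∀ t₁ ∈ Icc (0 : ℝ) 1, ∀ t₂ ∈ Icc (0 : ℝ) 1, t₁ < t₂ →
          ∫ x, φ x ∂(μ t₂) - ∫ x, φ x ∂(μ t₁)
            = ∫ s in t₁..t₂, ∫ x, fderiv ℝ φ x (v s x) ∂(μ s)

/-- Smoothness (`C^∞`) of a function on a set which need not be open: the function agrees with
a smooth function defined on an open neighbourhood of the set. The function `f` itself is taken to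
be that function, so that its derivatives at points of the set are the usual ones. -/
def IsSmoothOn {F G : Type*} [NormedAddCommGroup F] [NormedSpace ℝ F]
    [NormedAddCommGroup G] [NormedSpace ℝ G] (f : F → G) (s : Set F) : Prop :=
  ∃ U : Set F, IsOpen U ∧ s ⊆ U ∧ ContDiffOn ℝ ∞ f U

/-- `f` restricts to a diffeomorphism of `Ω` onto itself. -/
def IsDiffeoOn {E : Type*} [NormedAddCommGroup E] [NormedSpace ℝ E]
    (f : E → E) (Ω : Set E) : Prop :=
  IsSmoothOn f Ω ∧ MapsTo f Ω Ω ∧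
    ∃ g : E → E, IsSmoothOn g Ω ∧ MapsTo g Ω Ω ∧ InvOn g f Ω Ω

/-- The field `∇T_t · v_t + ∂T/∂t` at time `t` and at the point `x`. -/
noncomputable def transportedVelocity {E : Type*} [NormedAddCommGroup E] [NormedSpace ℝ E]
    (T : ℝ → E → E) (v : ℝ → E → E) (t : ℝ) (x : E) : E :=
  fderiv ℝ (T t) x (v t x) + deriv (fun s => T s x) t

/-- The identity of vector measures `v'_t · μ'_t = (T_t)♯[(∇T_t · v_t + ∂T/∂t) μ_t]` on `Ω`, where
`μ'_t = (T_t)♯μ_t`, for a.e. `t ∈ [0, 1]`: both sides give the same vector to every Borel set.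
(As for `v_t`, it is understood for a.e. `t`.) -/
def IsPushforwardField {E : Type*} [MeasurableSpace E] [NormedAddCommGroup E] [NormedSpace ℝ E]
    (Ω : Set E) (μ : ℝ → Measure E) (T : ℝ → E → E) (v v' : ℝ → E → E) : Prop :=
  ∀ᵐ t ∂(volume.restrict (Icc (0 : ℝ) 1)),
    Integrable (transportedVelocity T v t) (μ t) ∧ Integrable (v' t) ((μ t).map (T t)) ∧
      ∀ A : Set E, MeasurableSet A →
        ∫ y in A, v' t y ∂((μ t).map (T t))
          = ∫ x in Ω ∩ T t ⁻¹' A, transportedVelocity T v t x ∂(μ t)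

section Coupling

variable {E : Type*} [MeasurableSpace E] {π : Measure (E × E)} {μ ν : Measure E}

namespace IsCoupling

theorem measurePreserving_fst (h : IsCoupling π μ ν) : MeasurePreserving Prod.fst π μ :=
  ⟨measurable_fst, h.1⟩

theorem measurePreserving_snd (h : IsCoupling π μ ν) : MeasurePreserving Prod.snd π ν :=
  ⟨measurable_snd, h.2⟩

theorem isProbabilityMeasure [IsProbabilityMeasure μ] (h : IsCoupling π μ ν) :
    IsProbabilityMeasure π := by
  have : IsProbabilityMeasure (π.map Prod.fst) := h.1 ▸ ‹_›
  exact Measure.isProbabilityMeasure_of_map Prod.fst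

theorem diagonal (μ : Measure E) : IsCoupling (μ.map fun x => (x, x)) μ μ := by
  constructor <;> rw [Measure.map_map (by fun_prop) (by fun_prop)] <;> exact Measure.map_id

theorem map {F : Type*} [MeasurableSpace F] (h : IsCoupling π μ ν) {f g : E → F}
    (hf : AEMeasurable f μ) (hg : AEMeasurable g ν) :
    IsCoupling (π.map (Prod.map f g)) (μ.map f) (ν.map g) := by
  have hfg : AEMeasurable (Prod.map f g) π :=
    (hf.comp_quasiMeasurePreserving h.measurePreserving_fst.quasiMeasurePreserving).prodMk
      (hg.comp_quasiMeasurePreserving h.measurePreserving_snd.quasiMeasurePreserving)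
  rw [← h.1] at hf ⊢
  rw [← h.2] at hg ⊢
  constructor
  · rw [AEMeasurable.map_map_of_aemeasurable measurable_fst.aemeasurable hfg,
      AEMeasurable.map_map_of_aemeasurable hf measurable_fst.aemeasurable]
    rfl
  · rw [AEMeasurable.map_map_of_aemeasurable measurable_snd.aemeasurable hfg,
      AEMeasurable.map_map_of_aemeasurable hg measurable_snd.aemeasurable]
    rfl

end IsCoupling

variable [NormedAddCommGroup E]

theorem eLpNorm_ofReal_eq_lintegral_edist {p : ℝ} (hp : 0 < p) (π : Measure (E × E)) :
    eLpNorm (fun z : E × E => z.1 - z.2) (.ofReal p) π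
      = (∫⁻ z, edist z.1 z.2 ^ p ∂π) ^ (1 / p) := by
  rw [eLpNorm_eq_lintegral_rpow_enorm_toReal (by simpa) ENNReal.ofReal_ne_top,
    ENNReal.toReal_ofReal hp.le]
  simp only [edist_eq_enorm_sub]

theorem IsCoupling.wassersteinDist_le_eLpNorm {p : ℝ} (hp : 0 < p) (h : IsCoupling π μ ν) :
    wassersteinDist p μ ν ≤ eLpNorm (fun z : E × E => z.1 - z.2) (.ofReal p) π := by
  rw [eLpNorm_ofReal_eq_lintegral_edist hp]
  exact ENNReal.rpow_le_rpow (iInf₂_le π h) (by positivity)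

theorem exists_isCoupling_eLpNorm_lt {p : ℝ} (hp : 0 < p) {a : ℝ≥0∞}
    (h : wassersteinDist p μ ν < a) :
    ∃ π, IsCoupling π μ ν ∧ eLpNorm (fun z : E × E => z.1 - z.2) (.ofReal p) π < a := by
  rw [wassersteinDist, one_div, ENNReal.rpow_inv_lt_iff hp] at h
  simp only [iInf_lt_iff] at h
  obtain ⟨π, hπ, hlt⟩ := h
  refine ⟨π, hπ, ?_⟩
  rwa [eLpNorm_ofReal_eq_lintegral_edist hp, one_div, ENNReal.rpow_inv_lt_iff hp]

theorem mem_wassersteinSpace_iff [OpensMeasurableSpace E] [SecondCountableTopology E] {p : ℝ}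
    (hp : 0 < p) {Ω : Set E} : μ ∈ wassersteinSpace p Ω ↔
      IsProbabilityMeasure μ ∧ (∀ᵐ x ∂μ, x ∈ Ω) ∧ MemLp id (.ofReal p) μ := by
  have hmoment : MemLp id (.ofReal p) μ ↔ ∫⁻ x, ‖x‖ₑ ^ p ∂μ < ⊤ := by
    rw [MemLp, eLpNorm_lt_top_iff_lintegral_rpow_enorm_lt_top (by simpa) ENNReal.ofReal_ne_top,
      ENNReal.toReal_ofReal hp.le]
    exact and_iff_right aestronglyMeasurable_id
  rw [hmoment]
  rfl

/-- The infimum in the Wasserstein distance need not be attained, but the constant `L` can absorb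
the gap to the cost of a nearly optimal coupling. -/
theorem isLipschitzCurve_iff [OpensMeasurableSpace E] [SecondCountableTopology E] {p : ℝ}
    (hp : 0 < p) {Ω : Set E} {μ : ℝ → Measure E} : IsLipschitzCurve p Ω μ ↔
      (∀ t ∈ Icc (0 : ℝ) 1, μ t ∈ wassersteinSpace p Ω) ∧
        ∃ L : ℝ≥0, ∀ s ∈ Icc (0 : ℝ) 1, ∀ t ∈ Icc (0 : ℝ) 1, ∃ π, IsCoupling π (μ s) (μ t) ∧
          eLpNorm (fun z : E × E => z.1 - z.2) (.ofReal p) π ≤ L * edist s t := by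
  refine and_congr_right fun _ => ⟨fun ⟨L, hL⟩ => ⟨L + 1, fun s hs t ht => ?_⟩,
    fun ⟨L, hL⟩ => ⟨L, fun s hs t ht => ?_⟩⟩
  · rcases eq_or_ne s t with rfl | hst
    · refine ⟨_, .diagonal _, le_of_eq ?_⟩
      rw [eLpNorm_map_measure (by fun_prop) (by fun_prop)]
      simp [Function.comp_def]
    · have hlt : wassersteinDist p (μ s) (μ t) < (L + 1 : ℝ≥0) * edist s t :=
        (hL s hs t ht).trans_lt <| ENNReal.mul_lt_mul_left (edist_pos.2 hst).ne'
          (edist_ne_top s t) (by exact_mod_cast lt_add_one L)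
      obtain ⟨π, hπ, hlt⟩ := exists_isCoupling_eLpNorm_lt hp hlt
      exact ⟨π, hπ, hlt.le⟩
  · obtain ⟨π, hπ, hle⟩ := hL s hs t ht
    exact (hπ.wassersteinDist_le_eLpNorm hp).trans hle

end Coupling

section CouplingEstimates

variable {E F : Type*} [NormedAddCommGroup E] [MeasurableSpace E] [BorelSpace E]
  [SecondCountableTopology E] [NormedAddCommGroup F] {π : Measure (E × E)} {μ ν : Measure E}
  {q : ℝ≥0∞}

theorem eLpNorm_one_add_norm_le [IsProbabilityMeasure ν] (hq : 1 ≤ q) :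
    eLpNorm (fun y : E => 1 + ‖y‖) q ν ≤ 1 + eLpNorm id q ν := by
  refine (eLpNorm_add_le (f := fun _ => (1 : ℝ)) (by fun_prop) (by fun_prop) hq).trans ?_
  rw [eLpNorm_const _ (one_pos.trans_le hq).ne' (NeZero.ne ν), ← eLpNorm_norm (id : E → E)]
  simp

namespace IsCoupling

theorem edist_integral_le [NormedSpace ℝ F] [IsProbabilityMeasure μ] (h : IsCoupling π μ ν)
    (hq : 1 ≤ q) {K : ℝ≥0} {f : E → F} (hf : LipschitzWith K f) (hμ : Integrable f μ)
    (hν : Integrable f ν) :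
    edist (∫ x, f x ∂μ) (∫ x, f x ∂ν) ≤ K * eLpNorm (fun z : E × E => z.1 - z.2) q π := by
  have := h.isProbabilityMeasure
  have hμ' : Integrable (fun z : E × E => f z.1) π :=
    h.measurePreserving_fst.integrable_comp_of_integrable hμ
  have hν' : Integrable (fun z : E × E => f z.2) π :=
    h.measurePreserving_snd.integrable_comp_of_integrable hν
  have hμ_eq : ∫ x, f x ∂μ = ∫ z, f z.1 ∂π := by
    rw [← h.1, integral_map measurable_fst.aemeasurable (by rw [h.1]; exact hμ.1)]
  have hν_eq : ∫ x, f x ∂ν = ∫ z, f z.2 ∂π := by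
    rw [← h.2, integral_map measurable_snd.aemeasurable (by rw [h.2]; exact hν.1)]
  rw [hμ_eq, hν_eq, edist_eq_enorm_sub, ← integral_sub hμ' hν']
  calc ‖∫ z, (f z.1 - f z.2) ∂π‖ₑ
      ≤ eLpNorm (fun z : E × E => f z.1 - f z.2) 1 π := by
        rw [eLpNorm_one_eq_lintegral_enorm]
        exact enorm_integral_le_lintegral_enorm _
    _ ≤ K * eLpNorm (fun z : E × E => z.1 - z.2) 1 π := by
        refine eLpNorm_le_nnreal_smul_eLpNorm_of_ae_le_mul (ae_of_all _ fun z => ?_) 1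
        exact hf.norm_sub_le z.1 z.2
    _ ≤ K * eLpNorm (fun z : E × E => z.1 - z.2) q π := by
        gcongr
        exact eLpNorm_le_eLpNorm_of_exponent_le hq (by fun_prop)

theorem eLpNorm_id_le (h : IsCoupling π μ ν) (hq : 1 ≤ q) :
    eLpNorm id q ν ≤ eLpNorm id q μ + eLpNorm (fun z : E × E => z.1 - z.2) q π := by
  have hμ : eLpNorm (Prod.fst : E × E → E) q π = eLpNorm id q μ :=
    eLpNorm_comp_measurePreserving aestronglyMeasurable_id h.measurePreserving_fst
  have hν : eLpNorm (Prod.snd : E × E → E) q π = eLpNorm id q ν :=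
    eLpNorm_comp_measurePreserving aestronglyMeasurable_id h.measurePreserving_snd
  rw [← hμ, ← hν]
  calc eLpNorm (Prod.snd : E × E → E) q π
      = eLpNorm (Prod.fst - fun z : E × E => z.1 - z.2) q π := by
        congr 1; ext z; simp
    _ ≤ _ := eLpNorm_sub_le (by fun_prop) (by fun_prop) hq

theorem eLpNorm_map_sub_le [MeasurableSpace F] [BorelSpace F] [SecondCountableTopology F]
    [IsProbabilityMeasure ν] (h : IsCoupling π μ ν) (hq : 1 ≤ q) {Ω : Set E}
    (hμΩ : ∀ᵐ x ∂μ, x ∈ Ω) (hνΩ : ∀ᵐ x ∂ν, x ∈ Ω) {f g : E → F} (hf : AEMeasurable f μ)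
    (hg : AEMeasurable g ν) {K δ : ℝ≥0} (hK : LipschitzOnWith K f Ω)
    (hδ : ∀ y ∈ Ω, ‖f y - g y‖ ≤ δ * (1 + ‖y‖)) :
    eLpNorm (fun z : F × F => z.1 - z.2) q (π.map (Prod.map f g)) ≤
      δ * (1 + eLpNorm id q ν) + K * eLpNorm (fun z : E × E => z.1 - z.2) q π := by
  have hfg : AEMeasurable (Prod.map f g) π :=
    (hf.comp_quasiMeasurePreserving h.measurePreserving_fst.quasiMeasurePreserving).prodMk
      (hg.comp_quasiMeasurePreserving h.measurePreserving_snd.quasiMeasurePreserving)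
  have hbound : ∀ᵐ z ∂π, ‖f z.1 - g z.2‖ ≤ δ * (1 + ‖z.2‖) + K * ‖z.1 - z.2‖ := by
    filter_upwards [h.measurePreserving_fst.quasiMeasurePreserving.ae hμΩ,
      h.measurePreserving_snd.quasiMeasurePreserving.ae hνΩ] with z hz₁ hz₂
    calc ‖f z.1 - g z.2‖ ≤ ‖f z.1 - f z.2‖ + ‖f z.2 - g z.2‖ := norm_sub_le_norm_sub_add_norm_sub ..
      _ ≤ K * ‖z.1 - z.2‖ + δ * (1 + ‖z.2‖) := add_le_add (hK.norm_sub_le hz₁ hz₂) (hδ _ hz₂)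
      _ = _ := add_comm _ _
  rw [eLpNorm_map_measure (by fun_prop) hfg]
  calc eLpNorm (fun z => f z.1 - g z.2) q π
      ≤ eLpNorm ((fun z : E × E => δ * (1 + ‖z.2‖)) + fun z : E × E => K * ‖z.1 - z.2‖) q π :=
        eLpNorm_mono_ae_real hbound
    _ ≤ eLpNorm (fun z : E × E => (δ : ℝ) * (1 + ‖z.2‖)) q π
          + eLpNorm (fun z : E × E => (K : ℝ) * ‖z.1 - z.2‖) q π :=
        eLpNorm_add_le (by fun_prop) (by fun_prop) hq
    _ = δ * eLpNorm (fun y : E => 1 + ‖y‖) q ν + K * eLpNorm (fun z : E × E => z.1 - z.2) q π := by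
        have hconst (c : ℝ≥0) (u : E × E → ℝ) :
            eLpNorm (fun z => (c : ℝ) * u z) q π = c * eLpNorm u q π := by
          exact (eLpNorm_const_smul (c : ℝ) u q π).trans (by simp)
        rw [hconst, hconst, eLpNorm_norm, ← eLpNorm_comp_measurePreserving (by fun_prop)
          h.measurePreserving_snd]
        rfl
    _ ≤ _ := by
        gcongr
        exact eLpNorm_one_add_norm_le hq

end IsCoupling

end CouplingEstimates

section LipschitzCurve

open Filter Topology

variable {E F : Type*} [NormedAddCommGroup E] [MeasurableSpace E] [BorelSpace E]
  [SecondCountableTopology E] [NormedAddCommGroup F] {p : ℝ} {Ω : Set E}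

theorem aestronglyMeasurable_of_continuousOn {μ : Measure E} (hΩ : MeasurableSet Ω)
    (hμΩ : ∀ᵐ x ∂μ, x ∈ Ω) {f : E → F} (hf : ContinuousOn f Ω) : AEStronglyMeasurable f μ := by
  have h := hf.aestronglyMeasurable (μ := μ) hΩ
  rwa [Measure.restrict_eq_self_of_ae_mem hμΩ] at h

theorem integrable_of_mem_wassersteinSpace (hp : 1 ≤ p) {μ : Measure E}
    (hμ : μ ∈ wassersteinSpace p Ω) {K : ℝ≥0} {φ : E → F} (hφ : LipschitzWith K φ) :
    Integrable φ μ := by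
  obtain ⟨_, _, hid⟩ := (mem_wassersteinSpace_iff (one_pos.trans_le hp)).1 hμ
  have hid : Integrable id μ := hid.integrable (by simpa using hp)
  refine ((hid.norm.const_mul K).add (integrable_const ‖φ 0‖)).mono'
    hφ.continuous.aestronglyMeasurable (ae_of_all _ fun x => ?_)
  calc ‖φ x‖ ≤ ‖φ x - φ 0‖ + ‖φ 0‖ := norm_le_norm_sub_add ..
    _ ≤ K * ‖x‖ + ‖φ 0‖ := by simpa using hφ.norm_sub_le x 0

theorem map_mem_wassersteinSpace [MeasurableSpace F] [BorelSpace F] [SecondCountableTopology F]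
    (hp : 0 < p) (hΩ : MeasurableSet Ω) {μ : Measure E} (hμ : μ ∈ wassersteinSpace p Ω)
    {Ω' : Set F} (hΩ' : MeasurableSet Ω') {f : E → F} (hmaps : MapsTo f Ω Ω') {K : ℝ≥0}
    (hf : LipschitzOnWith K f Ω) : μ.map f ∈ wassersteinSpace p Ω' := by
  obtain ⟨_, hμΩ, hid⟩ := (mem_wassersteinSpace_iff hp).1 hμ
  have hmeas := aestronglyMeasurable_of_continuousOn hΩ hμΩ hf.continuousOn
  obtain ⟨x₀, hx₀⟩ := hμΩ.exists
  have hbound : ∀ᵐ x ∂μ, ‖f x‖ ≤ K * ‖x - x₀‖ + ‖f x₀‖ := by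
    filter_upwards [hμΩ] with x hx
    calc ‖f x‖ ≤ ‖f x - f x₀‖ + ‖f x₀‖ := norm_le_norm_sub_add ..
      _ ≤ K * ‖x - x₀‖ + ‖f x₀‖ := by gcongr; exact hf.norm_sub_le hx hx₀
  refine (mem_wassersteinSpace_iff hp).2 ⟨Measure.isProbabilityMeasure_map hmeas.aemeasurable,
    (ae_map_iff hmeas.aemeasurable hΩ').2 (hμΩ.mono hmaps), ?_⟩
  rw [memLp_map_measure_iff aestronglyMeasurable_id hmeas.aemeasurable]
  exact (((hid.sub (memLp_const x₀)).norm.const_mul (K : ℝ)).add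
    (memLp_const ‖f x₀‖)).mono' hmeas hbound

namespace IsLipschitzCurve

variable {μ : ℝ → Measure E}

theorem exists_lipschitzOnWith_integral [NormedSpace ℝ F] (hp : 1 ≤ p)
    (hμ : IsLipschitzCurve p Ω μ) :
    ∃ L : ℝ≥0, ∀ (K : ℝ≥0) (φ : E → F), LipschitzWith K φ →
      LipschitzOnWith (K * L) (fun t => ∫ x, φ x ∂μ t) (Icc 0 1) := by
  obtain ⟨hmem, L, hL⟩ := (isLipschitzCurve_iff (one_pos.trans_le hp)).1 hμ
  refine ⟨L, fun K φ hφ s hs t ht => ?_⟩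
  have := (hmem s hs).1
  obtain ⟨π, hπ, hcost⟩ := hL s hs t ht
  calc edist (∫ x, φ x ∂μ s) (∫ x, φ x ∂μ t)
      ≤ K * eLpNorm (fun z : E × E => z.1 - z.2) (.ofReal p) π :=
        hπ.edist_integral_le (by simpa using hp) hφ
          (integrable_of_mem_wassersteinSpace hp (hmem s hs) hφ)
          (integrable_of_mem_wassersteinSpace hp (hmem t ht) hφ)
    _ ≤ K * (L * edist s t) := by gcongr
    _ = (K * L : ℝ≥0) * edist s t := by push_cast; ring

theorem exists_eLpNorm_id_le (hp : 1 ≤ p) (hμ : IsLipschitzCurve p Ω μ) :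
    ∃ M : ℝ≥0, ∀ t ∈ Icc (0 : ℝ) 1, eLpNorm id (.ofReal p) (μ t) ≤ M := by
  have hp0 := one_pos.trans_le hp
  obtain ⟨hmem, L, hL⟩ := (isLipschitzCurve_iff hp0).1 hμ
  have h0 : (0 : ℝ) ∈ Icc (0 : ℝ) 1 := by simp
  have hfin := ((mem_wassersteinSpace_iff hp0).1 (hmem 0 h0)).2.2.eLpNorm_ne_top
  refine ⟨(eLpNorm id (.ofReal p) (μ 0)).toNNReal + L, fun t ht => ?_⟩
  obtain ⟨π, hπ, hcost⟩ := hL 0 h0 t ht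
  have hdist : edist 0 t ≤ 1 := by
    simpa [edist_dist, abs_of_nonneg ht.1] using ht.2
  calc eLpNorm id (.ofReal p) (μ t)
      ≤ eLpNorm id (.ofReal p) (μ 0) + eLpNorm (fun z : E × E => z.1 - z.2) (.ofReal p) π :=
        hπ.eLpNorm_id_le (by simpa using hp)
    _ ≤ eLpNorm id (.ofReal p) (μ 0) + L * 1 := by gcongr; exact hcost.trans (by gcongr)
    _ = _ := by rw [mul_one, ENNReal.coe_add, ENNReal.coe_toNNReal hfin]

theorem continuousOn_integral (hp : 1 ≤ p) (hμ : IsLipschitzCurve p Ω μ) {f : E → ℝ}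
    (hf : Continuous f) {C : ℝ} (hC : ∀ x, ‖f x‖ ≤ C) :
    ContinuousOn (fun t => ∫ x, f x ∂μ t) (Icc 0 1) := by
  obtain ⟨L, hL⟩ := hμ.exists_lipschitzOnWith_integral (F := ℝ) hp
  let P : Icc (0 : ℝ) 1 → ProbabilityMeasure E := fun t => ⟨μ t, (hμ.1 t t.2).1⟩
  rw [continuousOn_iff_continuous_domRestrict, continuous_iff_continuousAt]
  intro t
  have hnarrow : Tendsto P (𝓝 t) (𝓝 (P t)) := by
    rw [tendsto_iff_forall_lipschitz_integral_tendsto]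
    rintro φ - ⟨K, hK⟩
    exact (continuousOn_iff_continuous_domRestrict.1 (hL K φ hK).continuousOn).continuousAt
  exact ProbabilityMeasure.tendsto_iff_forall_integral_tendsto.1 hnarrow
    (BoundedContinuousFunction.ofNormedAddCommGroup f hf C hC)

theorem map [MeasurableSpace F] [BorelSpace F] [SecondCountableTopology F] (hp : 1 ≤ p)
    (hΩ : MeasurableSet Ω) (hμ : IsLipschitzCurve p Ω μ) {Ω' : Set F} (hΩ' : MeasurableSet Ω')
    {T : ℝ → E → F} (hmaps : ∀ t ∈ Icc (0 : ℝ) 1, MapsTo (T t) Ω Ω') {C D : ℝ≥0}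
    (hspace : ∀ t ∈ Icc (0 : ℝ) 1, LipschitzOnWith C (T t) Ω)
    (htime : ∀ x ∈ Ω, LipschitzOnWith (D * (1 + ‖x‖₊)) (fun t => T t x) (Icc 0 1)) :
    IsLipschitzCurve p Ω' fun t => (μ t).map (T t) := by
  have hp0 := one_pos.trans_le hp
  obtain ⟨M, hM⟩ := hμ.exists_eLpNorm_id_le hp
  obtain ⟨hmem, L, hL⟩ := (isLipschitzCurve_iff hp0).1 hμ
  have hμΩ (t) (ht : t ∈ Icc (0 : ℝ) 1) : ∀ᵐ x ∂μ t, x ∈ Ω :=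
    ((mem_wassersteinSpace_iff hp0).1 (hmem t ht)).2.1
  have hT (t) (ht : t ∈ Icc (0 : ℝ) 1) : AEMeasurable (T t) (μ t) :=
    (aestronglyMeasurable_of_continuousOn hΩ (hμΩ t ht) (hspace t ht).continuousOn).aemeasurable
  refine (isLipschitzCurve_iff hp0).2 ⟨fun t ht => map_mem_wassersteinSpace hp0 hΩ (hmem t ht) hΩ'
    (hmaps t ht) (hspace t ht), D * (1 + M) + C * L, fun s hs t ht => ?_⟩
  have := (hmem t ht).1
  obtain ⟨π, hπ, hcost⟩ := hL s hs t ht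
  refine ⟨_, hπ.map (hT s hs) (hT t ht), ?_⟩
  have htime' (y) (hy : y ∈ Ω) : ‖T s y - T t y‖ ≤ (D * nndist s t : ℝ≥0) * (1 + ‖y‖) := by
    refine ((htime y hy).norm_sub_le hs ht).trans_eq ?_
    push_cast [← dist_eq_norm]
    ring
  calc eLpNorm (fun z : F × F => z.1 - z.2) (.ofReal p) (π.map (Prod.map (T s) (T t)))
      ≤ (D * nndist s t : ℝ≥0) * (1 + eLpNorm id (.ofReal p) (μ t))
          + C * eLpNorm (fun z : E × E => z.1 - z.2) (.ofReal p) π :=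
        hπ.eLpNorm_map_sub_le (by simpa using hp) (hμΩ s hs) (hμΩ t ht) (hT s hs) (hT t ht)
          (hspace s hs) htime'
    _ ≤ (D * nndist s t : ℝ≥0) * (1 + M) + C * (L * edist s t) := by gcongr; exact hM t ht
    _ = (D * (1 + M) + C * L : ℝ≥0) * edist s t := by
        rw [edist_nndist]
        push_cast
        ring

end IsLipschitzCurve

end LipschitzCurve

section SpaceTimeFunctions

open Filter Topology

theorem hasCompactSupport_slice {α X M : Type*} [TopologicalSpace α] [TopologicalSpace X]
    [T2Space X] [Zero M] {Ψ : α × X → M} (hc : HasCompactSupport Ψ) (t : α) :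
    HasCompactSupport fun x => Ψ (t, x) :=
  .intro (IsCompact.image hc continuous_snd) fun _ hx =>
    image_eq_zero_of_notMem_tsupport fun h => hx ⟨_, h, rfl⟩

theorem integrable_slice {α X F : Type*} [TopologicalSpace α] [TopologicalSpace X] [T2Space X]
    [MeasurableSpace X] [OpensMeasurableSpace X] [NormedAddCommGroup F] {ν : Measure X}
    [IsFiniteMeasureOnCompacts ν] {Ψ : α × X → F} (hΨ : Continuous Ψ) (hc : HasCompactSupport Ψ)
    (t : α) : Integrable (fun x => Ψ (t, x)) ν :=
  (hΨ.comp (.prodMk_right t)).integrable_of_hasCompactSupport (hasCompactSupport_slice hc t)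

variable {E F : Type*} [NormedAddCommGroup E] [NormedSpace ℝ E] [NormedAddCommGroup F]
  [NormedSpace ℝ F] {Ψ : ℝ × E → F}

/-- The material derivative `∂_t Ψ + ∇Ψ · v`: the rate of change of a function `Ψ` on space-time
along the velocity field `v`. -/
noncomputable def materialDeriv (v : ℝ → E → E) (Ψ : ℝ × E → F) (t : ℝ) (x : E) : F :=
  fderiv ℝ Ψ (t, x) (1, v t x)

theorem hasFDerivAt_slice {t : ℝ} {x : E} (hΨ : DifferentiableAt ℝ Ψ (t, x)) :
    HasFDerivAt (fun y => Ψ (t, y)) ((fderiv ℝ Ψ (t, x)).comp (.inr ℝ ℝ E)) x :=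
  hΨ.hasFDerivAt.comp x (hasFDerivAt_prodMk_right t x)

theorem hasDerivAt_slice {t : ℝ} {x : E} (hΨ : DifferentiableAt ℝ Ψ (t, x)) :
    HasDerivAt (fun s => Ψ (s, x)) (fderiv ℝ Ψ (t, x) (1, 0)) t :=
  hΨ.hasFDerivAt.comp_hasDerivAt t ((hasDerivAt_id t).prodMk (hasDerivAt_const t x))

theorem eventually_forall_norm_fderiv_sub_le (hΨ : ContDiff ℝ 1 Ψ) (hc : HasCompactSupport Ψ)
    (t : ℝ) {ε : ℝ} (hε : 0 < ε) :
    ∀ᶠ s in 𝓝 t, ∀ x, ‖fderiv ℝ Ψ (s, x) - fderiv ℝ Ψ (t, x)‖ ≤ ε := by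
  have huc := (hc.fderiv ℝ).uniformContinuous_of_continuous (hΨ.continuous_fderiv one_ne_zero)
  obtain ⟨δ, hδ, h⟩ := Metric.uniformContinuous_iff.1 huc ε hε
  filter_upwards [Metric.ball_mem_nhds t hδ] with s hs x
  rw [← dist_eq_norm]
  exact (h (by simpa [Prod.dist_eq, hδ] using hs)).le

theorem eventually_lipschitzWith_slice_sub (hΨ : ContDiff ℝ 1 Ψ) (hc : HasCompactSupport Ψ)
    (t : ℝ) {ε : ℝ≥0} (hε : 0 < ε) :
    ∀ᶠ s in 𝓝 t, LipschitzWith ε fun x => Ψ (t, x) - Ψ (s, x) := by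
  have hd := hΨ.differentiable one_ne_zero
  filter_upwards [eventually_forall_norm_fderiv_sub_le hΨ hc t hε] with s hs
  have hderiv (x : E) := (hasFDerivAt_slice (hd (t, x))).fun_sub (hasFDerivAt_slice (hd (s, x)))
  refine lipschitzWith_of_nnnorm_fderiv_le (fun x => (hderiv x).differentiableAt) fun x => ?_
  rw [← NNReal.coe_le_coe, coe_nnnorm, (hderiv x).fderiv, ← ContinuousLinearMap.sub_comp,
    ← neg_sub, ContinuousLinearMap.neg_comp, norm_neg]
  calc ‖(fderiv ℝ Ψ (s, x) - fderiv ℝ Ψ (t, x)).comp (.inr ℝ ℝ E)‖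
      ≤ ‖fderiv ℝ Ψ (s, x) - fderiv ℝ Ψ (t, x)‖ * ‖ContinuousLinearMap.inr ℝ ℝ E‖ :=
        ContinuousLinearMap.opNorm_comp_le _ _
    _ ≤ ε * 1 := by gcongr; exacts [hs x, ContinuousLinearMap.norm_inr_le_one ℝ ℝ E]
    _ = ε := mul_one _

theorem eventually_forall_norm_slice_sub_sub_le (hΨ : ContDiff ℝ 1 Ψ) (hc : HasCompactSupport Ψ)
    (t : ℝ) {ε : ℝ} (hε : 0 < ε) :
    ∀ᶠ s in 𝓝 t, ∀ x,
      ‖Ψ (s, x) - Ψ (t, x) - (s - t) • fderiv ℝ Ψ (t, x) (1, 0)‖ ≤ ε * ‖s - t‖ := by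
  have hd := hΨ.differentiable one_ne_zero
  obtain ⟨δ, hδ, hball⟩ :=
    Metric.eventually_nhds_iff_ball.1 (eventually_forall_norm_fderiv_sub_le hΨ hc t hε)
  filter_upwards [Metric.ball_mem_nhds t hδ] with s hs x
  set b := fderiv ℝ Ψ (t, x) (1, 0)
  have hderiv (r : ℝ) :
      HasDerivAt (fun r => Ψ (r, x) - r • b) (fderiv ℝ Ψ (r, x) (1, 0) - b) r := by
    simpa using (hasDerivAt_slice (hd (r, x))).fun_sub ((hasDerivAt_id r).smul_const b)
  have hle (r) (hr : r ∈ Metric.ball t δ) : ‖fderiv ℝ Ψ (r, x) (1, 0) - b‖ ≤ ε := by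
    have h := (fderiv ℝ Ψ (r, x) - fderiv ℝ Ψ (t, x)).le_of_opNorm_le (hball r hr x) (1, 0)
    simpa [Prod.norm_def] using h
  have h := (convex_ball t δ).norm_image_sub_le_of_norm_hasDerivWithin_le
    (fun r _ => (hderiv r).hasDerivWithinAt) hle (Metric.mem_ball_self hδ) hs
  rwa [sub_sub_sub_comm, ← sub_smul] at h

variable [MeasurableSpace E] [BorelSpace E] [SecondCountableTopology E] {ν : Measure E}

theorem integrable_fderiv_slice_apply (hΨ : ContDiff ℝ 1 Ψ) (hc : HasCompactSupport Ψ) (t : ℝ)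
    {w : E → ℝ × E} (hw : Integrable w ν) : Integrable (fun x => fderiv ℝ Ψ (t, x) (w x)) ν := by
  have hcont := hΨ.continuous_fderiv one_ne_zero
  obtain ⟨B, hB⟩ := (hc.fderiv ℝ).exists_bound_of_continuous hcont
  exact (ContinuousLinearMap.id ℝ (ℝ × E →L[ℝ] F)).integrable_of_bilin_of_bdd_left B
    (hcont.comp (.prodMk_right t)).aestronglyMeasurable (ae_of_all _ fun x => hB (t, x)) hw

theorem continuous_integral_fderiv_slice_apply (hΨ : ContDiff ℝ 1 Ψ) (hc : HasCompactSupport Ψ)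
    {w : E → ℝ × E} (hw : Integrable w ν) :
    Continuous fun t => ∫ x, fderiv ℝ Ψ (t, x) (w x) ∂ν := by
  have hcont := hΨ.continuous_fderiv one_ne_zero
  obtain ⟨B, hB⟩ := (hc.fderiv ℝ).exists_bound_of_continuous hcont
  exact continuous_of_dominated (fun t => (integrable_fderiv_slice_apply hΨ hc t hw).1)
    (fun t => ae_of_all _ fun x => (fderiv ℝ Ψ (t, x)).le_of_opNorm_le (hB (t, x)) (w x))
    (hw.norm.const_mul B) (ae_of_all _ fun x => by fun_prop)

end SpaceTimeFunctions

section ContinuityEquation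

open Filter Topology

theorem hasDerivAt_of_tendsto {𝕜 F ι : Type*} [NontriviallyNormedField 𝕜] [NormedAddCommGroup F]
    [NormedSpace 𝕜 F] {l : Filter ι} [l.NeBot] {f : 𝕜 → F} {g : ι → 𝕜 → F} {a : F} {b : ι → F}
    {t : 𝕜} (hg : ∀ i, HasDerivAt (g i) (b i) t) (hb : Tendsto b l (𝓝 a))
    (hfg : ∀ ε > 0, ∀ᶠ i in l, ∀ᶠ s in 𝓝 t, ‖(f s - f t) - (g i s - g i t)‖ ≤ ε * ‖s - t‖) :
    HasDerivAt f a t := by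
  rw [hasDerivAt_iff_isLittleO, Asymptotics.isLittleO_iff]
  intro c hc
  have hc3 : 0 < c / 3 := by positivity
  obtain ⟨i, hi, hbi⟩ :=
    ((hfg _ hc3).and (hb.eventually (Metric.closedBall_mem_nhds a hc3))).exists
  filter_upwards [hi, (hasDerivAt_iff_isLittleO.1 (hg i)).bound hc3] with s h₁ h₂
  have h₃ : ‖(s - t) • (b i - a)‖ ≤ c / 3 * ‖s - t‖ := by
    rw [norm_smul, mul_comm, ← dist_eq_norm (b i)]
    gcongr
  calc ‖f s - f t - (s - t) • a‖
      = ‖((f s - f t) - (g i s - g i t)) + (g i s - g i t - (s - t) • b i)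
          + (s - t) • (b i - a)‖ := by
        rw [smul_sub]
        abel_nf
    _ ≤ c / 3 * ‖s - t‖ + c / 3 * ‖s - t‖ + c / 3 * ‖s - t‖ :=
        norm_add_le_of_le (norm_add_le_of_le h₁ h₂) h₃
    _ = c * ‖s - t‖ := by ring

theorem ae_restrict_Icc_mem_Ioo (a b : ℝ) :
    ∀ᵐ t ∂volume.restrict (Icc a b), t ∈ Ioo a b := by
  rw [← restrict_Ioo_eq_restrict_Icc]
  exact ae_restrict_mem measurableSet_Ioo

theorem integral_eq_sub_of_lipschitzOnWith {f f' : ℝ → ℝ} {a b : ℝ} (hab : a ≤ b) {K : ℝ≥0}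
    (hf : LipschitzOnWith K f (Icc a b))
    (hf' : ∀ᵐ t ∂volume.restrict (Icc a b), HasDerivAt f (f' t) t) :
    IntegrableOn f' (Icc a b) ∧ ∫ t in a..b, f' t = f b - f a := by
  have hac : AbsolutelyContinuousOnInterval f a b :=
    LipschitzOnWith.absolutelyContinuousOnInterval (by rwa [uIcc_of_le hab])
  have hderiv : f' =ᵐ[volume.restrict (Icc a b)] deriv f := hf'.mono fun _ ht => ht.deriv.symm
  refine ⟨?_, ?_⟩
  · have hint := hac.intervalIntegrable_deriv
    rw [intervalIntegrable_iff_integrableOn_Icc_of_le hab] at hint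
    exact hint.congr hderiv.symm
  · rw [← hac.integral_deriv_eq_sub]
    refine intervalIntegral.integral_congr_ae_restrict ?_
    rw [uIoc_of_le hab]
    exact ae_restrict_of_ae_restrict_of_subset Ioc_subset_Icc_self hderiv

variable {E : Type*} [NormedAddCommGroup E] [NormedSpace ℝ E] [MeasurableSpace E]
  {p : ℝ} {Ω : Set E} {μ : ℝ → Measure E} {v : ℝ → E → E}

theorem IsVelocityField.ae_hasDerivAt (hv : IsVelocityField p μ v) {φ : E → ℝ}
    (hφ : ContDiff ℝ 1 φ) (hc : HasCompactSupport φ) :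
    ∀ᵐ t ∂volume.restrict (Icc (0 : ℝ) 1),
      HasDerivAt (fun s => ∫ x, φ x ∂μ s) (∫ x, fderiv ℝ φ x (v t x) ∂μ t) t := by
  obtain ⟨hint, heq⟩ := hv.2 φ hφ hc
  rw [← intervalIntegrable_iff_integrableOn_Icc_of_le zero_le_one] at hint
  filter_upwards [ae_restrict_of_ae hint.ae_hasDerivAt_integral, ae_restrict_Icc_mem_Ioo 0 1]
    with t ht htI
  rw [uIcc_of_le zero_le_one] at ht
  have h := (ht (Ioo_subset_Icc_self htI) 0 (by simp)).const_add (∫ x, φ x ∂μ 0)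
  refine h.congr_of_eventuallyEq ?_
  filter_upwards [Ioo_mem_nhds htI.1 htI.2] with s hs
  rw [← heq 0 (by simp) s (Ioo_subset_Icc_self hs) hs.1]
  ring

variable [BorelSpace E] [SecondCountableTopology E] {Ψ : ℝ × E → ℝ}

/-- The exceptional set of times depends on the test function, so that the slice of `Ψ` at the
time of differentiation is out of reach of `IsVelocityField.ae_hasDerivAt`; but the countably many
slices of `Ψ` at rational times have a common exceptional set, and they approximate all others. -/
theorem IsVelocityField.ae_hasDerivAt_integral_slice (hp : 1 ≤ p) (hμ : IsLipschitzCurve p Ω μ)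
    (hv : IsVelocityField p μ v) (hΨ : ContDiff ℝ 1 Ψ) (hc : HasCompactSupport Ψ) :
    ∀ᵐ t ∂volume.restrict (Icc (0 : ℝ) 1),
      HasDerivAt (fun s => ∫ x, Ψ (t, x) ∂μ s) (∫ x, fderiv ℝ Ψ (t, x) (0, v t x) ∂μ t) t := by
  obtain ⟨L, hL⟩ := hμ.exists_lipschitzOnWith_integral (F := ℝ) hp
  have hrat : ∀ᵐ t ∂volume.restrict (Icc (0 : ℝ) 1), ∀ q : ℚ,
      HasDerivAt (fun s => ∫ x, Ψ (q, x) ∂μ s) (∫ x, fderiv ℝ Ψ (q, x) (0, v t x) ∂μ t) t := by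
    refine ae_all_iff.2 fun q => (hv.ae_hasDerivAt (hΨ.comp (contDiff_prodMk_right (q : ℝ)))
      (hasCompactSupport_slice hc q)).mono fun t ht => ?_
    simpa [Function.comp_def,
      (hasFDerivAt_slice (hΨ.differentiable one_ne_zero (_, _))).fderiv] using ht
  filter_upwards [hrat, hv.1, ae_restrict_Icc_mem_Ioo 0 1] with t hrat hvt ht
  have hprob (s : ℝ) (hs : s ∈ Ioo (0 : ℝ) 1) := (hμ.1 s (Ioo_subset_Icc_self hs)).1
  have := hprob t ht
  have hvt : Integrable (v t) (μ t) := hvt.integrable (by simpa using hp)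
  have : NeBot (comap ((↑) : ℚ → ℝ) (𝓝 t)) :=
    Rat.isDenseEmbedding_coe_real.isDenseInducing.comap_nhds_neBot t
  refine hasDerivAt_of_tendsto hrat (((continuous_integral_fderiv_slice_apply hΨ hc
    ((integrable_zero _ ℝ _).prodMk hvt)).tendsto t).comp tendsto_comap) fun ε hε => ?_
  obtain ⟨c, hc0, hcε⟩ := exists_pos_mul_lt hε L
  lift c to ℝ≥0 using hc0.le
  filter_upwards [tendsto_comap.eventually
    (eventually_lipschitzWith_slice_sub hΨ hc t (NNReal.coe_pos.1 hc0))] with q hq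
  filter_upwards [Ioo_mem_nhds ht.1 ht.2] with s hs
  have := hprob s hs
  have hint (r a : ℝ) [IsProbabilityMeasure (μ r)] : Integrable (fun x => Ψ (a, x)) (μ r) :=
    integrable_slice hΨ.continuous hc a
  have hlip := (hL c _ hq).norm_sub_le (Ioo_subset_Icc_self hs) (Ioo_subset_Icc_self ht)
  rw [integral_sub (hint s t) (hint s q), integral_sub (hint t t) (hint t q)] at hlip
  rw [sub_sub_sub_comm]
  refine hlip.trans ?_
  gcongr
  push_cast
  linarith

theorem IsLipschitzCurve.hasDerivAt_integral_slice_sub (hp : 1 ≤ p)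
    (hμ : IsLipschitzCurve p Ω μ) (hΨ : ContDiff ℝ 1 Ψ) (hc : HasCompactSupport Ψ) {t : ℝ}
    (ht : t ∈ Ioo (0 : ℝ) 1) :
    HasDerivAt (fun s => ∫ x, (Ψ (s, x) - Ψ (t, x)) ∂μ s)
      (∫ x, fderiv ℝ Ψ (t, x) (1, 0) ∂μ t) t := by
  set D : E → ℝ := fun x => fderiv ℝ Ψ (t, x) (1, 0)
  have hDcont : Continuous D := by
    have := hΨ.continuous_fderiv one_ne_zero
    fun_prop
  obtain ⟨B, hB⟩ :=
    (hasCompactSupport_slice (hc.fderiv_apply ℝ (1, 0)) t).exists_bound_of_continuous hDcont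
  have hnarrow := (hμ.continuousOn_integral hp hDcont hB).continuousAt (Icc_mem_nhds ht.1 ht.2)
  rw [hasDerivAt_iff_isLittleO, Asymptotics.isLittleO_iff]
  intro c hc0
  filter_upwards [Ioo_mem_nhds ht.1 ht.2,
    eventually_forall_norm_slice_sub_sub_le hΨ hc t (half_pos hc0),
    hnarrow (Metric.closedBall_mem_nhds _ (half_pos hc0))] with s hs htaylor hDs
  have := (hμ.1 s (Ioo_subset_Icc_self hs)).1
  have hint (a : ℝ) : Integrable (fun x => Ψ (a, x)) (μ s) :=
    integrable_slice hΨ.continuous hc a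
  have hsub : Integrable (fun x => Ψ (s, x) - Ψ (t, x)) (μ s) := (hint s).sub (hint t)
  have hD : Integrable (fun x => (s - t) • D x) (μ s) :=
    Integrable.smul (s - t) (.of_bound hDcont.aestronglyMeasurable B (ae_of_all _ hB))
  have hremainder : ‖∫ x, (Ψ (s, x) - Ψ (t, x) - (s - t) • D x) ∂μ s‖ ≤ c / 2 * ‖s - t‖ := by
    simpa using norm_integral_le_of_norm_le_const (ae_of_all (μ s) htaylor)
  have hvariation :
      ‖(s - t) • (∫ x, D x ∂μ s - ∫ x, D x ∂μ t)‖ ≤ c / 2 * ‖s - t‖ := by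
    rw [norm_smul, mul_comm, ← dist_eq_norm (∫ x, D x ∂μ s)]
    gcongr
    exact hDs
  calc ‖∫ x, (Ψ (s, x) - Ψ (t, x)) ∂μ s - ∫ x, (Ψ (t, x) - Ψ (t, x)) ∂μ t
          - (s - t) • ∫ x, D x ∂μ t‖
      = ‖∫ x, (Ψ (s, x) - Ψ (t, x) - (s - t) • D x) ∂μ s
          + (s - t) • (∫ x, D x ∂μ s - ∫ x, D x ∂μ t)‖ := by
        rw [integral_sub hsub hD, integral_smul, smul_sub]
        simp
    _ ≤ c / 2 * ‖s - t‖ + c / 2 * ‖s - t‖ := norm_add_le_of_le hremainder hvariation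
    _ = c * ‖s - t‖ := by ring

theorem IsVelocityField.ae_hasDerivAt_integral (hp : 1 ≤ p) (hμ : IsLipschitzCurve p Ω μ)
    (hv : IsVelocityField p μ v) (hΨ : ContDiff ℝ 1 Ψ) (hc : HasCompactSupport Ψ) :
    ∀ᵐ t ∂volume.restrict (Icc (0 : ℝ) 1),
      HasDerivAt (fun s => ∫ x, Ψ (s, x) ∂μ s) (∫ x, materialDeriv v Ψ t x ∂μ t) t := by
  filter_upwards [hv.ae_hasDerivAt_integral_slice hp hμ hΨ hc, ae_restrict_Icc_mem_Ioo 0 1, hv.1]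
    with t hslice ht hvt
  have := (hμ.1 t (Ioo_subset_Icc_self ht)).1
  have hvt : Integrable (v t) (μ t) := hvt.integrable (by simpa using hp)
  have hsplit : ∫ x, materialDeriv v Ψ t x ∂μ t
      = ∫ x, fderiv ℝ Ψ (t, x) (1, 0) ∂μ t + ∫ x, fderiv ℝ Ψ (t, x) (0, v t x) ∂μ t := by
    rw [← integral_add (integrable_fderiv_slice_apply hΨ hc t (integrable_const (1, 0)))
      (integrable_fderiv_slice_apply hΨ hc t ((integrable_const (0 : ℝ)).prodMk hvt))]
    simp [materialDeriv, ← map_add]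
  rw [hsplit]
  refine ((hμ.hasDerivAt_integral_slice_sub hp hΨ hc ht).add hslice).congr_of_eventuallyEq ?_
  filter_upwards [Ioo_mem_nhds ht.1 ht.2] with s hs
  have := (hμ.1 s (Ioo_subset_Icc_self hs)).1
  rw [Pi.add_apply, integral_sub (integrable_slice hΨ.continuous hc s)
    (integrable_slice hΨ.continuous hc t), sub_add_cancel]

theorem IsLipschitzCurve.exists_lipschitzOnWith_integral_slice (hp : 1 ≤ p)
    (hμ : IsLipschitzCurve p Ω μ) (hΨ : ContDiff ℝ 1 Ψ) (hc : HasCompactSupport Ψ) :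
    ∃ K, LipschitzOnWith K (fun t => ∫ x, Ψ (t, x) ∂μ t) (Icc 0 1) := by
  obtain ⟨L, hL⟩ := hμ.exists_lipschitzOnWith_integral (F := ℝ) hp
  obtain ⟨K, hK⟩ := hΨ.lipschitzWith_of_hasCompactSupport hc one_ne_zero
  refine ⟨K + K * L, .of_dist_le_mul fun s hs t ht => ?_⟩
  have := (hμ.1 s hs).1
  have htime : ‖∫ x, Ψ (s, x) ∂μ s - ∫ x, Ψ (t, x) ∂μ s‖ ≤ K * dist s t := by
    rw [← integral_sub (integrable_slice hΨ.continuous hc s) (integrable_slice hΨ.continuous hc t)]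
    have hle (x : E) : ‖Ψ (s, x) - Ψ (t, x)‖ ≤ K * dist s t := by
      simpa [dist_eq_norm, Prod.norm_def] using hK.dist_le_mul (s, x) (t, x)
    simpa using norm_integral_le_of_norm_le_const (ae_of_all (μ s) hle)
  have hcurve : dist (∫ x, Ψ (t, x) ∂μ s) (∫ x, Ψ (t, x) ∂μ t) ≤ K * L * dist s t := by
    have hslice : LipschitzWith K fun x => Ψ (t, x) := by
      simpa [Function.comp_def] using hK.comp (LipschitzWith.prodMk_left t)
    simpa using (hL K _ hslice).dist_le_mul s hs t ht
  rw [← dist_eq_norm] at htime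
  refine (dist_triangle _ (∫ x, Ψ (t, x) ∂μ s) _).trans ((add_le_add htime hcurve).trans_eq ?_)
  push_cast
  ring

theorem IsVelocityField.integral_slice_sub_eq (hp : 1 ≤ p) (hμ : IsLipschitzCurve p Ω μ)
    (hv : IsVelocityField p μ v) (hΨ : ContDiff ℝ 1 Ψ) (hc : HasCompactSupport Ψ) :
    IntegrableOn (fun s => ∫ x, materialDeriv v Ψ s x ∂μ s) (Icc (0 : ℝ) 1) ∧
      ∀ t₁ ∈ Icc (0 : ℝ) 1, ∀ t₂ ∈ Icc (0 : ℝ) 1, t₁ < t₂ →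
        ∫ x, Ψ (t₂, x) ∂μ t₂ - ∫ x, Ψ (t₁, x) ∂μ t₁
          = ∫ s in t₁..t₂, ∫ x, materialDeriv v Ψ s x ∂μ s := by
  obtain ⟨K, hK⟩ := hμ.exists_lipschitzOnWith_integral_slice hp hΨ hc
  have hderiv := hv.ae_hasDerivAt_integral hp hμ hΨ hc
  refine ⟨(integral_eq_sub_of_lipschitzOnWith zero_le_one hK hderiv).1,
    fun t₁ h₁ t₂ h₂ hlt => ?_⟩
  have hsub : Icc t₁ t₂ ⊆ Icc 0 1 := Icc_subset_Icc h₁.1 h₂.2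
  exact (integral_eq_sub_of_lipschitzOnWith hlt.le (hK.mono hsub)
    (ae_restrict_of_ae_restrict_of_subset hsub hderiv)).2.symm

end ContinuityEquation

section Homeomorphisms

open Filter Topology

/-- `f` restricts to a homeomorphism of `Ω` onto itself; the inverse is a function on the whole
space of which only the values on `Ω` matter. -/
def IsHomeoOn {X : Type*} [TopologicalSpace X] (f : X → X) (Ω : Set X) : Prop :=
  ContinuousOn f Ω ∧ MapsTo f Ω Ω ∧ ∃ g : X → X, ContinuousOn g Ω ∧ MapsTo g Ω Ω ∧ InvOn g f Ω Ω

namespace IsHomeoOn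

variable {X : Type*} [TopologicalSpace X] {f : X → X} {Ω K : Set X}

theorem exists_inter_preimage_eq_image (hf : IsHomeoOn f Ω) :
    ∃ g : X → X, ContinuousOn g Ω ∧ ∀ K, Ω ∩ f ⁻¹' K = g '' (Ω ∩ K) := by
  obtain ⟨-, hmaps, g, hg, hgmaps, hinv⟩ := hf
  refine ⟨g, hg, fun K => ?_⟩
  rw [inter_comm Ω K, hinv.2.image_inter', (hinv.symm.bijOn hgmaps hmaps).image_eq, inter_comm]

theorem isCompact_inter_preimage (hf : IsHomeoOn f Ω) (hK : IsCompact (Ω ∩ K)) :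
    IsCompact (Ω ∩ f ⁻¹' K) := by
  obtain ⟨g, hg, himage⟩ := hf.exists_inter_preimage_eq_image
  rw [himage]
  exact hK.image_of_continuousOn (hg.mono inter_subset_left)

theorem isPreconnected_inter_preimage (hf : IsHomeoOn f Ω) (hK : IsPreconnected (Ω ∩ K)) :
    IsPreconnected (Ω ∩ f ⁻¹' K) := by
  obtain ⟨g, hg, himage⟩ := hf.exists_inter_preimage_eq_image
  rw [himage]
  exact hK.image g (hg.mono inter_subset_left)

end IsHomeoOn

theorem eventually_forall_lt_of_isCompact {α X β : Type*} [TopologicalSpace α] [TopologicalSpace X]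
    [TopologicalSpace β] [LinearOrder β] [OrderClosedTopology β] {J : Set α} {K : Set X}
    (hK : IsCompact K) {f : α × X → β} (hf : ContinuousOn f (J ×ˢ K)) {t : α} (ht : t ∈ J) {c : β}
    (hc : ∀ x ∈ K, c < f (t, x)) : ∀ᶠ s in 𝓝[J] t, ∀ x ∈ K, c < f (s, x) := by
  refine eventually_nhdsWithin_iff.2 <| (hK.eventually_forall_of_forall_eventually
    (P := fun s x => s ∈ J → x ∈ K → c < f (s, x)) fun x hx => ?_).mono
      fun s h hs x hx => h x hx hs hx
  filter_upwards [eventually_nhdsWithin_iff.1 ((hf (t, x) ⟨ht, hx⟩).eventually_const_lt (hc x hx))]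
    with z hz hJ hK using hz ⟨hJ, hK⟩

variable {α E : Type*} [TopologicalSpace α] [NormedAddCommGroup E] [NormedSpace ℝ E]
  [ProperSpace E] {J : Set α} {Ω : Set E} {T : α → E → E}

/-- At time `t` the preimage of a ball does not meet a large sphere, hence neither do the preimages
at nearby times; as they are connected and contain a common point `x₀` inside the sphere, they
cannot leave it. -/
theorem exists_eventually_forall_norm_le_of_norm_apply_le (hΩ : IsClosed Ω) (hconv : Convex ℝ Ω)
    (hT : ContinuousOn (Function.uncurry T) (J ×ˢ Ω)) (hhomeo : ∀ t ∈ J, IsHomeoOn (T t) Ω)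
    {t : α} (ht : t ∈ J) (r : ℝ) :
    ∃ R, ∀ᶠ s in 𝓝[J] t, ∀ x ∈ Ω, ‖T s x‖ ≤ r → ‖x‖ ≤ R := by
  rcases Ω.eq_empty_or_nonempty with rfl | ⟨x₀, hx₀⟩
  · exact ⟨0, by simp⟩
  set r' := max r (‖T t x₀‖ + 1)
  have hcompact : IsCompact (Ω ∩ T t ⁻¹' Metric.closedBall 0 r') :=
    (hhomeo t ht).isCompact_inter_preimage ((isCompact_closedBall 0 r').inter_left hΩ)
  obtain ⟨R₀, hR₀⟩ := hcompact.isBounded.exists_norm_le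
  set R := max R₀ ‖x₀‖ + 1
  have hsphere : ∀ᶠ s in 𝓝[J] t, ∀ x ∈ Ω ∩ Metric.sphere 0 R, r' < ‖T s x‖ := by
    refine eventually_forall_lt_of_isCompact ((isCompact_sphere 0 R).inter_left hΩ)
      (hT.mono (prod_mono_right inter_subset_left)).norm ht fun x hx => ?_
    by_contra! hle
    have := hR₀ x ⟨hx.1, by simpa using hle⟩
    rw [mem_sphere_zero_iff_norm.1 hx.2] at this
    exact this.not_gt ((le_max_left ..).trans_lt (lt_add_one _))
  have hbase : ∀ᶠ s in 𝓝[J] t, ‖T s x₀‖ < ‖T t x₀‖ + 1 :=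
    ((hT.comp (Continuous.prodMk_left x₀).continuousOn fun _ hs => ⟨hs, hx₀⟩) t
      ht).norm.eventually_lt_const (lt_add_one _)
  refine ⟨R, ?_⟩
  filter_upwards [hsphere, hbase, self_mem_nhdsWithin] with s hsphere hbase hs x hx hxr
  have hconn : IsPreconnected (Ω ∩ T s ⁻¹' Metric.closedBall 0 r') :=
    (hhomeo s hs).isPreconnected_inter_preimage
      (hconv.inter (convex_closedBall 0 r')).isPreconnected
  have hmem (y) (hy : y ∈ Ω) (hyr : ‖T s y‖ ≤ r') : y ∈ Ω ∩ T s ⁻¹' Metric.closedBall 0 r' :=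
    ⟨hy, by simpa using hyr⟩
  by_contra! hlt
  obtain ⟨z, ⟨hz, hzr⟩, hzR⟩ := hconn.intermediate_value
    (hmem x₀ hx₀ (hbase.le.trans (le_max_right ..))) (hmem x hx (hxr.trans (le_max_left ..)))
    continuous_norm.continuousOn ⟨(le_max_right ..).trans (lt_add_one _).le, hlt.le⟩
  exact (hsphere z ⟨hz, by simpa using hzR⟩).not_ge (by simpa using hzr)

theorem exists_forall_norm_le_of_norm_apply_le (hΩ : IsClosed Ω) (hconv : Convex ℝ Ω)
    (hJ : IsCompact J) (hT : ContinuousOn (Function.uncurry T) (J ×ˢ Ω))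
    (hhomeo : ∀ t ∈ J, IsHomeoOn (T t) Ω) (r : ℝ) :
    ∃ R, ∀ t ∈ J, ∀ x ∈ Ω, ‖T t x‖ ≤ r → ‖x‖ ≤ R := by
  refine hJ.induction_on (p := fun s => ∃ R, ∀ t ∈ s, ∀ x ∈ Ω, ‖T t x‖ ≤ r → ‖x‖ ≤ R)
    (by simp) (fun s s' hss' ⟨R, hR⟩ => ⟨R, fun t ht => hR t (hss' ht)⟩) ?_ fun t ht => ?_
  · rintro s s' ⟨R, hR⟩ ⟨R', hR'⟩
    refine ⟨max R R', fun t ht x hx hr => ?_⟩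
    rcases ht with ht | ht
    exacts [(hR t ht x hx hr).trans (le_max_left ..), (hR' t ht x hx hr).trans (le_max_right ..)]
  · obtain ⟨R, hR⟩ :=
      exists_eventually_forall_norm_le_of_norm_apply_le hΩ hconv hT hhomeo ht r
    exact ⟨_, hR, R, fun _ h => h⟩

theorem isCompact_prod_inter_preimage_uncurry [T2Space α] (hΩ : IsClosed Ω) (hconv : Convex ℝ Ω)
    (hJ : IsCompact J) (hT : ContinuousOn (Function.uncurry T) (J ×ˢ Ω))
    (hhomeo : ∀ t ∈ J, IsHomeoOn (T t) Ω) {K : Set E} (hK : IsCompact K) :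
    IsCompact (J ×ˢ Ω ∩ Function.uncurry T ⁻¹' K) := by
  obtain ⟨r, hr⟩ := hK.isBounded.exists_norm_le
  obtain ⟨R, hR⟩ := exists_forall_norm_le_of_norm_apply_le hΩ hconv hJ hT hhomeo r
  refine (hJ.prod (isCompact_closedBall 0 R)).of_isClosed_subset
    (hT.preimage_isClosed_of_isClosed (hJ.isClosed.prod hΩ) hK.isClosed) ?_
  rintro ⟨t, x⟩ ⟨⟨ht, hx⟩, hxK⟩
  exact ⟨ht, by simpa using hR t ht x hx (hr _ hxK)⟩

end Homeomorphisms

section TestFunctions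

open Filter Topology
open scoped Manifold

theorem exists_contDiff_hasCompactSupport_eventuallyEq {H F : Type*} [NormedAddCommGroup H]
    [NormedSpace ℝ H] [FiniteDimensional ℝ H] [NormedAddCommGroup F] [NormedSpace ℝ F] {n : ℕ}
    {f : H → F} {S : Set H} (hf : ∀ z ∈ S, ContDiffAt ℝ n f z) (hS : IsCompact (S ∩ tsupport f)) :
    ∃ Ψ : H → F, ContDiff ℝ n Ψ ∧ HasCompactSupport Ψ ∧ ∀ z ∈ S, Ψ =ᶠ[𝓝 z] f := by
  have hopen : IsOpen {z | ContDiffAt ℝ n f z} :=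
    isOpen_iff_eventually.2 fun z (hz : ContDiffAt ℝ n f z) => hz.eventually (by simp)
  obtain ⟨L, hL, hSL, hLf⟩ := exists_compact_between hS hopen fun z hz => hf z hz.1
  obtain ⟨χ, hχ_one, hχ_zero, -⟩ :=
    exists_contMDiffMap_one_nhds_of_subset_interior (n := n) 𝓘(ℝ, H) hS.isClosed hSL
  have hχ : ContDiff ℝ n χ := contMDiff_iff_contDiff.1 χ.contMDiff
  refine ⟨fun z => χ z • f z, contDiff_iff_contDiffAt.2 fun z => ?_,
    .intro hL fun z hz => by simp [hχ_zero z hz], fun z hz => ?_⟩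
  · by_cases hzL : z ∈ L
    · exact hχ.contDiffAt.smul (hLf hzL)
    · refine (contDiffAt_const (c := (0 : F))).congr_of_eventuallyEq ?_
      filter_upwards [hL.isClosed.isOpen_compl.mem_nhds hzL] with y hy
      simp [hχ_zero y hy]
  · by_cases hzf : z ∈ tsupport f
    · filter_upwards [eventually_nhdsSet_iff_forall.1 hχ_one z ⟨hz, hzf⟩] with y hy
      simp [hy]
    · filter_upwards [notMem_tsupport_iff_eventuallyEq.1 hzf] with y hy
      simp [hy]

theorem exists_contDiff_hasCompactSupport_eventuallyEq_comp_uncurry {G E F : Type*}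
    [NormedAddCommGroup G] [NormedSpace ℝ G] [FiniteDimensional ℝ G] [NormedAddCommGroup E]
    [NormedSpace ℝ E] [FiniteDimensional ℝ E] [NormedAddCommGroup F] [NormedSpace ℝ F] {n : ℕ}
    {J : Set G} {Ω : Set E} {T : G → E → E} (hΩ : IsClosed Ω)
    (hconv : Convex ℝ Ω) (hJ : IsCompact J)
    (hT : ∀ z ∈ J ×ˢ Ω, ContDiffAt ℝ n (Function.uncurry T) z)
    (hhomeo : ∀ t ∈ J, IsHomeoOn (T t) Ω) {φ : E → F} (hφ : ContDiff ℝ n φ)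
    (hc : HasCompactSupport φ) :
    ∃ Ψ : G × E → F, ContDiff ℝ n Ψ ∧ HasCompactSupport Ψ ∧
      ∀ z ∈ J ×ˢ Ω, Ψ =ᶠ[𝓝 z] φ ∘ Function.uncurry T := by
  have := FiniteDimensional.proper ℝ E
  refine exists_contDiff_hasCompactSupport_eventuallyEq
    (fun z hz => hφ.contDiffAt.comp z (hT z hz)) ?_
  refine (isCompact_prod_inter_preimage_uncurry hΩ hconv hJ
    (fun z hz => (hT z hz).continuousAt.continuousWithinAt) hhomeo hc).of_isClosed_subset
    ((hJ.isClosed.prod hΩ).inter (isClosed_tsupport _)) fun z ⟨hz, hzf⟩ => ⟨hz, ?_⟩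
  by_contra hTz
  refine notMem_tsupport_iff_eventuallyEq.2 ?_ hzf
  exact (hT z hz).continuousAt.eventually (notMem_tsupport_iff_eventuallyEq.1 hTz)

end TestFunctions

section PushforwardField

open Filter Topology

section Measure

theorem comp_comp_ae_eq_of_ae_leftInverse {X Y F : Type*} [MeasurableSpace X] {μ : Measure X}
    {f : X → Y} {g : Y → X} {w : X → F} (hgf : ∀ᵐ x ∂μ, g (f x) = x) :
    (w ∘ g) ∘ f =ᵐ[μ] w :=
  hgf.mono fun _ hx => congrArg w hx

variable {X Y F : Type*} [MeasurableSpace X] [MeasurableSpace Y] [NormedAddCommGroup F]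
  {μ : Measure X} {f : X → Y} {g : Y → X} {w : X → F} {u : Y → F}

theorem map_map_of_ae_leftInverse (hf : AEMeasurable f μ) (hg : AEMeasurable g (μ.map f))
    (hgf : ∀ᵐ x ∂μ, g (f x) = x) : (μ.map f).map g = μ := by
  rw [AEMeasurable.map_map_of_aemeasurable hg hf]
  exact (Measure.map_congr (g := id) hgf).trans Measure.map_id

theorem integrable_comp_of_ae_leftInverse (hf : AEMeasurable f μ) (hg : AEMeasurable g (μ.map f))
    (hgf : ∀ᵐ x ∂μ, g (f x) = x) (hw : Integrable w μ) : Integrable (w ∘ g) (μ.map f) :=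
  Integrable.comp_aemeasurable (by rwa [map_map_of_ae_leftInverse hf hg hgf]) hg

variable [NormedSpace ℝ F]

theorem setIntegral_map_eq_of_comp_ae_eq (hf : AEMeasurable f μ)
    (hu : AEStronglyMeasurable u (μ.map f)) (huw : u ∘ f =ᵐ[μ] w) {A : Set Y}
    (hA : MeasurableSet A) : ∫ y in A, u y ∂μ.map f = ∫ x in f ⁻¹' A, w x ∂μ := by
  rw [setIntegral_map hA hu hf]
  exact integral_congr_ae (ae_restrict_of_ae huw)

theorem forall_setIntegral_map_eq_iff [CompleteSpace F] (hf : AEMeasurable f μ)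
    (hg : AEMeasurable g (μ.map f)) (hgf : ∀ᵐ x ∂μ, g (f x) = x) (hw : Integrable w μ)
    (hu : Integrable u (μ.map f)) :
    (∀ A, MeasurableSet A → ∫ y in A, u y ∂μ.map f = ∫ x in f ⁻¹' A, w x ∂μ) ↔
      u ∘ f =ᵐ[μ] w := by
  refine ⟨fun h => ?_, fun huw A hA => setIntegral_map_eq_of_comp_ae_eq hf hu.1 huw hA⟩
  have hwg := integrable_comp_of_ae_leftInverse hf hg hgf hw
  have hwgf : (w ∘ g) ∘ f =ᵐ[μ] w := comp_comp_ae_eq_of_ae_leftInverse hgf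
  have hug : u =ᵐ[μ.map f] w ∘ g := hu.ae_eq_of_forall_setIntegral_eq _ _ hwg fun A hA _ =>
    (h A hA).trans (setIntegral_map_eq_of_comp_ae_eq hf hwg.1 hwgf hA).symm
  have hugf : u ∘ f =ᵐ[μ] (w ∘ g) ∘ f := ae_of_ae_map hf hug
  exact hugf.trans hwgf

end Measure

section TransportedVelocity

variable {E : Type*} [NormedAddCommGroup E] [NormedSpace ℝ E] {T : ℝ → E → E}

theorem transportedVelocity_eq_materialDeriv (v : ℝ → E → E) {t : ℝ} {x : E}
    (hT : DifferentiableAt ℝ (Function.uncurry T) (t, x)) :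
    transportedVelocity T v t x = materialDeriv v (Function.uncurry T) t x := by
  have hspace : HasFDerivAt (T t) _ x := hasFDerivAt_slice hT
  have htime : HasDerivAt (fun s => T s x) _ t := hasDerivAt_slice hT
  rw [transportedVelocity, hspace.fderiv, htime.deriv]
  simp [materialDeriv, ← map_add]

theorem materialDeriv_comp_uncurry {F : Type*} [NormedAddCommGroup F] [NormedSpace ℝ F]
    {φ : E → F} (v : ℝ → E → E) {t : ℝ} {x : E}
    (hT : DifferentiableAt ℝ (Function.uncurry T) (t, x)) (hφ : DifferentiableAt ℝ φ (T t x)) :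
    materialDeriv v (φ ∘ Function.uncurry T) t x
      = fderiv ℝ φ (T t x) (transportedVelocity T v t x) := by
  rw [transportedVelocity_eq_materialDeriv v hT, materialDeriv, fderiv_comp (t, x) hφ hT]
  rfl

variable [MeasurableSpace E] [BorelSpace E] [SecondCountableTopology E] {Ω : Set E}

theorem memLp_transportedVelocity (hΩ : MeasurableSet Ω) {μ : Measure E} [IsFiniteMeasure μ]
    (hμΩ : ∀ᵐ x ∂μ, x ∈ Ω) {p : ℝ≥0∞} (hid : MemLp id p μ) {t : ℝ}
    (hT : ∀ x ∈ Ω, ContDiffAt ℝ 1 (Function.uncurry T) (t, x)) {C : ℝ}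
    (hC : ∀ x ∈ Ω, ‖fderiv ℝ (T t) x‖ ≤ C ∧ ‖deriv (fun s => T s x) t‖ ≤ C * (1 + ‖x‖))
    {v : ℝ → E → E} (hv : MemLp (v t) p μ) : MemLp (transportedVelocity T v t) p μ := by
  have hderiv : AEStronglyMeasurable (fun x => fderiv ℝ (Function.uncurry T) (t, x)) μ :=
    aestronglyMeasurable_of_continuousOn hΩ hμΩ fun x hx =>
      (((hT x hx).continuousAt_fderiv one_ne_zero).comp
        (Continuous.prodMk_right t).continuousAt).continuousWithinAt
  have hmeas : AEStronglyMeasurable (transportedVelocity T v t) μ := by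
    refine ((ContinuousLinearMap.id ℝ (ℝ × E →L[ℝ] E)).aestronglyMeasurable_comp₂ hderiv
      ((aestronglyMeasurable_const (b := (1 : ℝ))).prodMk hv.1)).congr ?_
    filter_upwards [hμΩ] with x hx
    exact (transportedVelocity_eq_materialDeriv v
      ((hT x hx).differentiableAt one_ne_zero)).symm
  refine ((hv.norm.const_mul C).add
    (((memLp_const (1 : ℝ)).add hid.norm).const_mul C)).mono' hmeas ?_
  filter_upwards [hμΩ] with x hx
  exact norm_add_le_of_le ((fderiv ℝ (T t) x).le_of_opNorm_le (hC x hx).1 (v t x)) (hC x hx).2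

theorem IsVelocityField.ae_memLp_transportedVelocity {p : ℝ} (hp : 0 < p) (hΩ : MeasurableSet Ω)
    {μ : ℝ → Measure E} (hμ : IsLipschitzCurve p Ω μ) {v : ℝ → E → E}
    (hv : IsVelocityField p μ v)
    (hT : ∀ t ∈ Icc (0 : ℝ) 1, ∀ x ∈ Ω, ContDiffAt ℝ 1 (Function.uncurry T) (t, x)) {C : ℝ}
    (hC : ∀ t ∈ Icc (0 : ℝ) 1, ∀ x ∈ Ω,
      ‖fderiv ℝ (T t) x‖ ≤ C ∧ ‖deriv (fun s => T s x) t‖ ≤ C * (1 + ‖x‖)) :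
    ∀ᵐ t ∂volume.restrict (Icc (0 : ℝ) 1),
      MemLp (transportedVelocity T v t) (.ofReal p) (μ t) := by
  filter_upwards [hv.1, ae_restrict_mem measurableSet_Icc] with t hvt ht
  obtain ⟨_, hμΩ, hid⟩ := (mem_wassersteinSpace_iff hp).1 (hμ.1 t ht)
  exact memLp_transportedVelocity hΩ hμΩ hid (hT t ht) (hC t ht) hvt

theorem IsLipschitzCurve.map_of_norm_fderiv_le {p : ℝ} (hp : 1 ≤ p) (hΩ : MeasurableSet Ω)
    (hconv : Convex ℝ Ω) {μ : ℝ → Measure E} (hμ : IsLipschitzCurve p Ω μ)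
    {Ω' : Set E} (hΩ' : MeasurableSet Ω') (hmaps : ∀ t ∈ Icc (0 : ℝ) 1, MapsTo (T t) Ω Ω')
    (hT : ∀ t ∈ Icc (0 : ℝ) 1, ∀ x ∈ Ω, DifferentiableAt ℝ (Function.uncurry T) (t, x)) {C : ℝ}
    (hC : ∀ t ∈ Icc (0 : ℝ) 1, ∀ x ∈ Ω,
      ‖fderiv ℝ (T t) x‖ ≤ C ∧ ‖deriv (fun s => T s x) t‖ ≤ C * (1 + ‖x‖)) :
    IsLipschitzCurve p Ω' fun t => (μ t).map (T t) := by
  refine hμ.map hp hΩ hΩ' hmaps (C := C.toNNReal) (D := C.toNNReal) (fun t ht => ?_) fun x hx => ?_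
  · exact hconv.lipschitzOnWith_of_nnnorm_fderiv_le
      (fun x hx => (hasFDerivAt_slice (hT t ht x hx)).differentiableAt)
      fun x hx => NNReal.le_toNNReal_of_coe_le (hC t ht x hx).1
  · refine (convex_Icc 0 1).lipschitzOnWith_of_nnnorm_deriv_le
      (fun t ht => (hasDerivAt_slice (hT t ht x hx)).differentiableAt) fun t ht => ?_
    rw [← NNReal.coe_le_coe]
    push_cast
    exact (hC t ht x hx).2.trans (by gcongr; exact Real.le_coe_toNNReal C)

end TransportedVelocity

variable {E : Type*} [NormedAddCommGroup E] [MeasurableSpace E] [BorelSpace E]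
  [SecondCountableTopology E] {Ω : Set E}

theorem IsHomeoOn.aemeasurable (hΩ : MeasurableSet Ω) {μ : Measure E} (hμΩ : ∀ᵐ x ∂μ, x ∈ Ω)
    {f : E → E} (hf : IsHomeoOn f Ω) : AEMeasurable f μ :=
  (aestronglyMeasurable_of_continuousOn hΩ hμΩ hf.1).aemeasurable

theorem IsHomeoOn.exists_ae_leftInverse (hΩ : MeasurableSet Ω) {μ : Measure E}
    (hμΩ : ∀ᵐ x ∂μ, x ∈ Ω) {f : E → E} (hf : IsHomeoOn f Ω) :
    ∃ g : E → E, AEMeasurable g (μ.map f) ∧ ∀ᵐ x ∂μ, g (f x) = x := by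
  obtain ⟨-, hmaps, g, hg, -, hinv⟩ := id hf
  have hmap : ∀ᵐ y ∂μ.map f, y ∈ Ω :=
    (ae_map_iff (hf.aemeasurable hΩ hμΩ) hΩ).2 (hμΩ.mono hmaps)
  exact ⟨g, (aestronglyMeasurable_of_continuousOn hΩ hmap hg).aemeasurable,
    hμΩ.mono fun _ hx => hinv.1 hx⟩

variable [NormedSpace ℝ E] {μ : ℝ → Measure E} {T : ℝ → E → E} {v v' : ℝ → E → E}

theorem isPushforwardField_iff [CompleteSpace E] (hΩ : MeasurableSet Ω)
    (hμΩ : ∀ t ∈ Icc (0 : ℝ) 1, ∀ᵐ x ∂μ t, x ∈ Ω)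
    (hhomeo : ∀ t ∈ Icc (0 : ℝ) 1, IsHomeoOn (T t) Ω) :
    IsPushforwardField Ω μ T v v' ↔ ∀ᵐ t ∂volume.restrict (Icc (0 : ℝ) 1),
      Integrable (transportedVelocity T v t) (μ t) ∧ Integrable (v' t) ((μ t).map (T t)) ∧
        v' t ∘ T t =ᵐ[μ t] transportedVelocity T v t := by
  refine eventually_congr ?_
  filter_upwards [ae_restrict_mem measurableSet_Icc] with t ht
  obtain ⟨g, hg, hgf⟩ := (hhomeo t ht).exists_ae_leftInverse hΩ (hμΩ t ht)
  refine and_congr_right fun hw => and_congr_right fun hv' => ?_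
  rw [← forall_setIntegral_map_eq_iff ((hhomeo t ht).aemeasurable hΩ (hμΩ t ht)) hg hgf hw hv']
  have hinter (A : Set E) : (Ω ∩ T t ⁻¹' A : Set E) =ᵐ[μ t] T t ⁻¹' A :=
    inter_eventuallyEq_right.2 <| (hμΩ t ht).mono fun _ hx _ => hx
  simp only [setIntegral_congr_set (hinter _)]

theorem exists_isPushforwardField [CompleteSpace E] (hΩ : MeasurableSet Ω)
    (hμΩ : ∀ t ∈ Icc (0 : ℝ) 1, ∀ᵐ x ∂μ t, x ∈ Ω)
    (hhomeo : ∀ t ∈ Icc (0 : ℝ) 1, IsHomeoOn (T t) Ω)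
    (hw : ∀ᵐ t ∂volume.restrict (Icc (0 : ℝ) 1), Integrable (transportedVelocity T v t) (μ t)) :
    ∃ v' : ℝ → E → E, IsPushforwardField Ω μ T v v' := by
  choose! g hg hgf using fun t ht => (hhomeo t ht).exists_ae_leftInverse hΩ (hμΩ t ht)
  refine ⟨fun t => transportedVelocity T v t ∘ g t, (isPushforwardField_iff hΩ hμΩ hhomeo).2 ?_⟩
  filter_upwards [hw, ae_restrict_mem measurableSet_Icc] with t hwt ht
  exact ⟨hwt, integrable_comp_of_ae_leftInverse ((hhomeo t ht).aemeasurable hΩ (hμΩ t ht))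
    (hg t ht) (hgf t ht) hwt, comp_comp_ae_eq_of_ae_leftInverse (hgf t ht)⟩

theorem integral_fderiv_map_eq_integral_materialDeriv {F : Type*} [NormedAddCommGroup F]
    [NormedSpace ℝ F] {ν : Measure E} {t : ℝ} (hTm : AEMeasurable (T t) ν)
    (hT : ∀ᵐ x ∂ν, DifferentiableAt ℝ (Function.uncurry T) (t, x)) {φ : E → F}
    (hφ : ContDiff ℝ 1 φ) {Ψ : ℝ × E → F}
    (hΨ : ∀ᵐ x ∂ν, Ψ =ᶠ[𝓝 (t, x)] φ ∘ Function.uncurry T) {u : E → E}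
    (hu : AEStronglyMeasurable u (ν.map (T t))) (huT : u ∘ T t =ᵐ[ν] transportedVelocity T v t) :
    ∫ y, fderiv ℝ φ y (u y) ∂ν.map (T t) = ∫ x, materialDeriv v Ψ t x ∂ν := by
  have hmeas : AEStronglyMeasurable (fun y => fderiv ℝ φ y (u y)) (ν.map (T t)) :=
    (ContinuousLinearMap.id ℝ (E →L[ℝ] F)).aestronglyMeasurable_comp₂
      (hφ.continuous_fderiv one_ne_zero).aestronglyMeasurable hu
  rw [integral_map hTm hmeas]
  refine integral_congr_ae ?_
  filter_upwards [hT, hΨ, huT] with x hTx hΨx hux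
  rw [← Function.comp_apply (f := u), hux, ← materialDeriv_comp_uncurry v hTx
    (hφ.differentiable one_ne_zero _), materialDeriv, materialDeriv, hΨx.fderiv_eq]

theorem IsPushforwardField.isVelocityField [FiniteDimensional ℝ E] {p : ℝ} (hp : 1 ≤ p)
    (hΩ : IsClosed Ω) (hconv : Convex ℝ Ω) (hμ : IsLipschitzCurve p Ω μ)
    (hT : ∀ t ∈ Icc (0 : ℝ) 1, ∀ x ∈ Ω, ContDiffAt ℝ 1 (Function.uncurry T) (t, x))
    (hhomeo : ∀ t ∈ Icc (0 : ℝ) 1, IsHomeoOn (T t) Ω) (hv : IsVelocityField p μ v)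
    (hw : ∀ᵐ t ∂volume.restrict (Icc (0 : ℝ) 1),
      MemLp (transportedVelocity T v t) (.ofReal p) (μ t))
    (hv' : IsPushforwardField Ω μ T v v') : IsVelocityField p (fun t => (μ t).map (T t)) v' := by
  have hμΩ (t) (ht : t ∈ Icc (0 : ℝ) 1) : ∀ᵐ x ∂μ t, x ∈ Ω := (hμ.1 t ht).2.1
  have hTm (t) (ht : t ∈ Icc (0 : ℝ) 1) : AEMeasurable (T t) (μ t) :=
    (hhomeo t ht).aemeasurable hΩ.measurableSet (hμΩ t ht)
  have := FiniteDimensional.complete ℝ E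
  rw [isPushforwardField_iff hΩ.measurableSet hμΩ hhomeo] at hv'
  refine ⟨?_, fun φ hφ hc => ?_⟩
  · filter_upwards [hw, hv', ae_restrict_mem measurableSet_Icc] with t hwt ⟨_, hvt, hvw⟩ ht
    exact (memLp_map_measure_iff hvt.1 (hTm t ht)).2 (hwt.ae_eq hvw.symm)
  obtain ⟨Ψ, hΨ, hΨc, hΨφ⟩ := exists_contDiff_hasCompactSupport_eventuallyEq_comp_uncurry (n := 1)
    hΩ hconv isCompact_Icc (fun z hz => by exact_mod_cast hT z.1 hz.1 z.2 hz.2) hhomeo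
    (by exact_mod_cast hφ) hc
  obtain ⟨hint, heq⟩ := hv.integral_slice_sub_eq hp hμ (by exact_mod_cast hΨ) hΨc
  have hlhs (t) (ht : t ∈ Icc (0 : ℝ) 1) :
      ∫ y, φ y ∂(μ t).map (T t) = ∫ x, Ψ (t, x) ∂μ t := by
    rw [integral_map (hTm t ht) hφ.continuous.aestronglyMeasurable]
    exact integral_congr_ae ((hμΩ t ht).mono fun x hx => (hΨφ (t, x) ⟨ht, hx⟩).eq_of_nhds.symm)
  have hrhs : (fun t => ∫ y, fderiv ℝ φ y (v' t y) ∂(μ t).map (T t))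
      =ᵐ[volume.restrict (Icc 0 1)] fun t => ∫ x, materialDeriv v Ψ t x ∂μ t := by
    filter_upwards [hv', ae_restrict_mem measurableSet_Icc] with t ⟨_, hvt, hvw⟩ ht
    exact integral_fderiv_map_eq_integral_materialDeriv (hTm t ht)
      ((hμΩ t ht).mono fun x hx => (hT t ht x hx).differentiableAt one_ne_zero) hφ
      ((hμΩ t ht).mono fun x hx => hΨφ (t, x) ⟨ht, hx⟩) hvt.1 hvw
  refine ⟨hint.congr hrhs.symm, fun t₁ h₁ t₂ h₂ hlt => ?_⟩
  rw [hlhs t₁ h₁, hlhs t₂ h₂, heq t₁ h₁ t₂ h₂ hlt]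
  refine intervalIntegral.integral_congr_ae_restrict ?_
  rw [uIoc_of_le hlt.le]
  exact ae_restrict_of_ae_restrict_of_subset
    (Ioc_subset_Icc_self.trans (Icc_subset_Icc h₁.1 h₂.2)) hrhs.symm

end PushforwardField

section Diffeomorphisms

theorem IsSmoothOn.contDiffAt {F G : Type*} [NormedAddCommGroup F] [NormedSpace ℝ F]
    [NormedAddCommGroup G] [NormedSpace ℝ G] {f : F → G} {s : Set F} (hf : IsSmoothOn f s) {x : F}
    (hx : x ∈ s) : ContDiffAt ℝ ∞ f x := by
  obtain ⟨U, hU, hsU, hf⟩ := hf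
  exact hf.contDiffAt (hU.mem_nhds (hsU hx))

theorem IsSmoothOn.continuousOn {F G : Type*} [NormedAddCommGroup F] [NormedSpace ℝ F]
    [NormedAddCommGroup G] [NormedSpace ℝ G] {f : F → G} {s : Set F} (hf : IsSmoothOn f s) :
    ContinuousOn f s :=
  fun _ hx => (hf.contDiffAt hx).continuousAt.continuousWithinAt

theorem IsDiffeoOn.isHomeoOn {E : Type*} [NormedAddCommGroup E] [NormedSpace ℝ E] {f : E → E}
    {Ω : Set E} (hf : IsDiffeoOn f Ω) : IsHomeoOn f Ω := by
  obtain ⟨hsmooth, hmaps, g, hg, hgmaps, hinv⟩ := hf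
  exact ⟨hsmooth.continuousOn, hmaps, g, hg.continuousOn, hgmaps, hinv⟩

end Diffeomorphisms

theorem mainTheorem4_general {E : Type*} [NormedAddCommGroup E] [NormedSpace ℝ E]
    [FiniteDimensional ℝ E] [MeasurableSpace E] [BorelSpace E] {Ω : Set E} (hΩ : IsClosed Ω)
    (hconv : Convex ℝ Ω) {p : ℝ} (hp : 1 ≤ p) {μ : ℝ → Measure E} (hμ : IsLipschitzCurve p Ω μ)
    {T : ℝ → E → E}
    (hT : ∀ t ∈ Icc (0 : ℝ) 1, ∀ x ∈ Ω, ContDiffAt ℝ 1 (Function.uncurry T) (t, x))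
    (hhomeo : ∀ t ∈ Icc (0 : ℝ) 1, IsHomeoOn (T t) Ω)
    (hbound : ∃ C : ℝ, ∀ t ∈ Icc (0 : ℝ) 1, ∀ x ∈ Ω,
      ‖fderiv ℝ (T t) x‖ ≤ C ∧ ‖deriv (fun s => T s x) t‖ ≤ C * (1 + ‖x‖))
    {v : ℝ → E → E} (hv : IsVelocityField p μ v) :
    IsLipschitzCurve p Ω (fun t => (μ t).map (T t)) ∧
      (∃ v' : ℝ → E → E, IsPushforwardField Ω μ T v v') ∧
      ∀ v' : ℝ → E → E, IsPushforwardField Ω μ T v v' →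
        IsVelocityField p (fun t => (μ t).map (T t)) v' := by
  have := FiniteDimensional.proper ℝ E
  obtain ⟨C, hC⟩ := hbound
  have hw := hv.ae_memLp_transportedVelocity (one_pos.trans_le hp) hΩ.measurableSet hμ hT hC
  refine ⟨hμ.map_of_norm_fderiv_le hp hΩ.measurableSet hconv hΩ.measurableSet
    (fun t ht => (hhomeo t ht).2.1) (fun t ht x hx => (hT t ht x hx).differentiableAt one_ne_zero)
    hC, ?_, fun v' hv' => hv'.isVelocityField hp hΩ hconv hμ hT hhomeo hv hw⟩
  refine exists_isPushforwardField hΩ.measurableSet (fun t ht => (hμ.1 t ht).2.1) hhomeo ?_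
  filter_upwards [hw, ae_restrict_mem measurableSet_Icc] with t hwt ht
  have := (hμ.1 t ht).1
  exact hwt.integrable (by simpa using hp)

theorem mainTheorem4 (d : ℕ) (Ω : Set (EuclideanSpace ℝ (Fin d))) (hΩ_closed : IsClosed Ω)
    (hΩ_convex : Convex ℝ Ω) (p : ℝ) (hp : 1 < p)
    (μ : ℝ → Measure (EuclideanSpace ℝ (Fin d))) (hμ : IsLipschitzCurve p Ω μ)
    (T : ℝ → EuclideanSpace ℝ (Fin d) → EuclideanSpace ℝ (Fin d))
    (hT_smooth : IsSmoothOn (fun z : ℝ × EuclideanSpace ℝ (Fin d) => T z.1 z.2)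
      (Icc (0 : ℝ) 1 ×ˢ Ω))
    (hT_diffeo : ∀ t ∈ Icc (0 : ℝ) 1, IsDiffeoOn (T t) Ω)
    (hT_bound : ∃ C : ℝ, ∀ t ∈ Icc (0 : ℝ) 1, ∀ x ∈ Ω,
      ‖fderiv ℝ (T t) x‖ ≤ C ∧ ‖deriv (fun s => T s x) t‖ ≤ C * (1 + ‖x‖))
    (v : ℝ → EuclideanSpace ℝ (Fin d) → EuclideanSpace ℝ (Fin d))
    (hv : IsVelocityField p μ v) :
    IsLipschitzCurve p Ω (fun t => (μ t).map (T t)) ∧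
      (∃ v' : ℝ → EuclideanSpace ℝ (Fin d) → EuclideanSpace ℝ (Fin d),
        IsPushforwardField Ω μ T v v') ∧
      ∀ v' : ℝ → EuclideanSpace ℝ (Fin d) → EuclideanSpace ℝ (Fin d),
        IsPushforwardField Ω μ T v v' →
          IsVelocityField p (fun t => (μ t).map (T t)) v' :=
  mainTheorem4_general hΩ_closed hΩ_convex hp.le hμ
    (fun _ ht _ hx => (hT_smooth.contDiffAt ⟨ht, hx⟩).of_le (by simp))
    (fun t ht => (hT_diffeo t ht).isHomeoOn) hT_bound hv
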